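/- Let $m\in\mathbb N$, let $A\in\mathbb R^{m\times m}$, and let $B=(B_t)_{t\ge 0}$ be a standard Brownian motion in $\mathbb R^m$ on a probability space $(\Omega,\mathcal A,\mathbb P)$. For $x\in\mathbb R^m$ let $(X_t(x))_{t\ge 0}$ be the solution of $$\mathrm dX_t(x)=-AX_t(x)\,\mathrm dt+\mathrm dB_t,\qquad X_0(x)=x,$$ and let $\mu$ be its stationary (invariant) probability distribution on $\mathbb R^m$. Let $\mathcal W_2$ be the Wasserstein distance of order $2$, $$\mathcal W_2(\mu_1,\mu_2)=\Big(\inf_{\mathcal T}\int_{\mathbb R^m\times\mathbb R^m}|u-v|^2\,\mathcal T(\mathrm du,\mathrm dv)\Big)^{1/2},$$ where the infimum is over all couplings $\mathcal T$ of $\mu_1$ and $\mu_2$, and write $\mathcal W_2(X_t(x),\mu)$ for the distance between the law of $X_t(x)$ and $\mu$. (1) Assume that $A$ is symmetric positive definite with eigenvalues $\lambda_1,\dots,\lambda_m>0$ and corresponding orthonormal eigenvectors $v_1,\dots,v_m\in\mathbb R^m$. Then for all $x\in\mathbb R^m$ and $t\ge 0$ $$\mathcal W_2(X_t(x),\mu)=\left(\sum_{j=1}^m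 e^{-2\lambda_jt}\langle x,v_j\rangle^2+\frac12\sum_{j=1}^m\frac1{\lambda_j}\,\frac{e^{-4\lambda_jt}}{\big(\sqrt{1-e^{-2\lambda_jt}}+1\big)^2}\right)^{1/2}.$$ (2) Assume that $A$ is normal, that is, $AA^*=A^*A$, with eigenvalues $\lambda_1,\dots,\lambda_m\in\mathbb C$ such that $\mathrm{Re}(\lambda_j)>0$ for all $j$, and corresponding orthonormal eigenvectors $v_1,\dots,v_m\in\mathbb C^m$. Then for all $x\in\mathbb R^m$ and $t\ge 0$ $$\mathcal W_2(X_t(x),\mu)=\left(\sum_{j=1}^m e^{-2\mathrm{Re}(\lambda_j)t}\Big(\langle x,\mathrm{Re}(v_j)\rangle^2+\langle x,\mathrm{Im}(v_j)\rangle^2\Big)+\sum_{j=1}^m\frac1{2\mathrm{Re}(\lambda_j)}\,\frac{e^{-4\mathrm{Re}(\lambda_j)t}}{\big(\sqrt{1-e^{-2\mathrm{Re}(\lambda_j)t}}+1\big)^2}\right)^{1/2}.$$ -/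

import Mathlib

open MeasureTheory ProbabilityTheory
open scoped NNReal ENNReal

noncomputable section

/-- The couplings (joint distributions) of two measures `μ` and `ν`. -/
def couplings {E : Type*} [MeasurableSpace E] (μ ν : Measure E) : Set (Measure (E × E)) :=
  {π | π.map Prod.fst = μ ∧ π.map Prod.snd = ν}

/-- The Wasserstein-Kantorovich-Rubinstein distance of order `p > 0`, with values in `[0, ∞]`
(so that no integrability convention is involved). -/
def wassersteinDist {E : Type*} [MeasurableSpace E] [EDist E] (p : ℝ) (μ ν : Measure E) : ℝ≥0∞ :=
  (⨅ π ∈ couplings μ ν, ∫⁻ z, edist z.1 z.2 ^ p ∂π) ^ min 1 (1 / p)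

/-- `B` is a standard Brownian motion in `ℝⁿ`: its components are independent standard
one-dimensional Brownian motions (started in `0`, with almost surely continuous paths). -/
structure IsStandardBrownianMotion {n : ℕ} {Ω : Type*} [MeasurableSpace Ω]
    (B : ℝ≥0 → Ω → EuclideanSpace ℝ (Fin n)) (P : Measure Ω) : Prop where
  isBrownianReal : ∀ i : Fin n, IsBrownianReal (fun t ω => B t ω i) P
  indep : iIndepFun (fun (i : Fin n) (ω : Ω) (t : ℝ≥0) => B t ω i) P

/-- `X` solves the linear stochastic differential equation with additive noise
`dX_t = -A X_t dt + σ dB_t`, `X_0 = x`, for a driving process `B` with continuous paths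
and `B_0 = 0`: almost surely, `X` has continuous paths and
`X_t = x - ∫₀ᵗ A X_s ds + σ B_t` for all `t ≥ 0`.
As the noise is additive with constant coefficient, no stochastic integral is needed. -/
def IsOrnsteinUhlenbeck {m n : ℕ} {Ω : Type*} [MeasurableSpace Ω]
    (A : Matrix (Fin m) (Fin m) ℝ) (σ : Matrix (Fin m) (Fin n) ℝ)
    (B : ℝ≥0 → Ω → EuclideanSpace ℝ (Fin n)) (P : Measure Ω)
    (x : EuclideanSpace ℝ (Fin m)) (X : ℝ≥0 → Ω → EuclideanSpace ℝ (Fin m)) : Prop :=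
  ∀ᵐ ω ∂P, Continuous (fun t => X t ω) ∧
    ∀ t : ℝ≥0, X t ω = x - (∫ s in (0 : ℝ)..(t : ℝ), Matrix.toEuclideanLin A (X s.toNNReal ω))
      + Matrix.toEuclideanLin σ (B t ω)

/-- `μ` is an invariant (stationary) probability distribution of the random dynamics
`x ↦ (X_t(x))_{t ≥ 0}`: if the initial value is distributed according to `μ`, independently of the
noise, then so is the value at each time `t`, that is, `∫ ℙ(X_t(x) ∈ S) μ(dx) = μ(S)`. -/
structure IsInvariantDistribution {E Ω : Type*} [MeasurableSpace E] [MeasurableSpace Ω]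
    (X : E → ℝ≥0 → Ω → E) (P : Measure Ω) (μ : Measure E) : Prop where
  isProbabilityMeasure : IsProbabilityMeasure μ
  invariant : ∀ (t : ℝ≥0) (S : Set E), MeasurableSet S → ∫⁻ x, P.map (X x t) S ∂μ = μ S

end

/-!
The solution is a Gaussian vector around the flow `exp (-tA) x`: after integration by parts,
variation of constants expresses its components through Wiener integrals of smooth functions,
which are limits of Riemann sums of independent Gaussian increments. Letting `T → ∞` in the
invariance equation shows that `μ` is a centred Gaussian.

For normal `A`, the covariances at time `t` and at infinity are functions of `(A + Aᵀ) / 2`.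
The eigenvectors of `A` diagonalise this matrix; a complex eigenbasis does so through the real and
imaginary parts of its vectors, which form a Parseval frame of `ℝᵐ` rather than a basis. In each
frame coordinate the transport cost is at least the squared difference of the means plus that of
the standard deviations, and driving both Gaussian vectors by the same noise attains all these
bounds at once.
-/

section ParsevalFrame

variable {E κ : Type*} [NormedAddCommGroup E] [InnerProductSpace ℝ E] [Fintype κ] {w : κ → E}

/-- A finite Parseval frame of a real inner product space: every vector is recovered from its
frame coefficients as it would be from its coordinates in an orthonormal basis. It lets the
real and imaginary parts of a complex orthonormal basis serve as real coordinates. -/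
def IsParsevalFrame (w : κ → E) : Prop :=
  ∀ x, ∑ k, inner ℝ (w k) x • w k = x

lemma IsParsevalFrame.sum_sq_inner (hw : IsParsevalFrame w) (x : E) :
    ∑ k, inner ℝ (w k) x ^ 2 = ‖x‖ ^ 2 := by
  rw [← real_inner_self_eq_norm_sq]
  nth_rewrite 2 [← hw x]
  simp only [sum_inner, inner_smul_left, conj_trivial, pow_two]

/-- The frame multiplier `x ↦ ∑ k, c k ⟨w k, x⟩ w k` with symbol `c`. It serves as the
functional calculus of an operator whose eigenvectors form the frame. -/
noncomputable def frameMultiplier (w : κ → E) (c : κ → ℝ) : E →L[ℝ] E :=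
  ∑ k, c k • InnerProductSpace.rankOne ℝ (w k) (w k)

lemma frameMultiplier_apply (w : κ → E) (c : κ → ℝ) (x : E) :
    frameMultiplier w c x = ∑ k, (c k * inner ℝ (w k) x) • w k := by
  simp [frameMultiplier, sum_apply, smul_smul]

variable [CompleteSpace E]

lemma adjoint_frameMultiplier (w : κ → E) (c : κ → ℝ) :
    (frameMultiplier w c).adjoint = frameMultiplier w c := by
  simp [frameMultiplier]

lemma IsParsevalFrame.frameMultiplier_apply_self (hw : IsParsevalFrame w) {S : E →L[ℝ] E}
    (hS : IsSelfAdjoint S) {s : κ → ℝ} (hs : ∀ k, S (w k) = s k • w k) (f : ℝ → ℝ) (k : κ) :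
    frameMultiplier w (fun i => f (s i)) (w k) = f (s k) • w k := by
  have orthogonal_of_ne : ∀ i, s i ≠ s k → inner ℝ (w i) (w k) = 0 := fun i hi => by
    have h := hS.isSymmetric (w i) (w k)
    simp only [ContinuousLinearMap.coe_coe, hs, inner_smul_left, inner_smul_right,
      conj_trivial] at h
    exact (mul_eq_mul_right_iff.1 h).resolve_left hi
  calc frameMultiplier w (fun i => f (s i)) (w k)
      = ∑ i, (f (s k) * inner ℝ (w i) (w k)) • w i := by
        rw [frameMultiplier_apply]
        refine Finset.sum_congr rfl fun i _ => ?_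
        by_cases hi : s i = s k
        · rw [hi]
        · rw [orthogonal_of_ne i hi, mul_zero, mul_zero]
    _ = f (s k) • w k := by
        simp_rw [mul_smul, ← Finset.smul_sum, hw (w k)]

lemma IsParsevalFrame.norm_frameMultiplier_apply_sq (hw : IsParsevalFrame w) {S : E →L[ℝ] E}
    (hS : IsSelfAdjoint S) {s : κ → ℝ} (hs : ∀ k, S (w k) = s k • w k) (f : ℝ → ℝ) (x : E) :
    ‖frameMultiplier w (fun i => f (s i)) x‖ ^ 2 = ∑ k, f (s k) ^ 2 * inner ℝ (w k) x ^ 2 := by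
  rw [← hw.sum_sq_inner]
  refine Finset.sum_congr rfl fun k _ => ?_
  rw [← ContinuousLinearMap.adjoint_inner_left, adjoint_frameMultiplier,
    hw.frameMultiplier_apply_self hS hs, inner_smul_left, conj_trivial, mul_pow]

end ParsevalFrame

section Wasserstein

lemma wassersteinDist_two_eq_ofReal_sqrt {E : Type*} [MeasurableSpace E] [EDist E]
    {μ ν : Measure E} {π : Measure (E × E)} {c : ℝ} (hc : 0 ≤ c) (hπ : π ∈ couplings μ ν)
    (hcost : ∫⁻ z, edist z.1 z.2 ^ (2 : ℝ) ∂π = ENNReal.ofReal c)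
    (hle : ∀ ρ ∈ couplings μ ν, ENNReal.ofReal c ≤ ∫⁻ z, edist z.1 z.2 ^ (2 : ℝ) ∂ρ) :
    wassersteinDist 2 μ ν = ENNReal.ofReal √c := by
  have hinf : (⨅ ρ ∈ couplings μ ν, ∫⁻ z, edist z.1 z.2 ^ (2 : ℝ) ∂ρ) = ENNReal.ofReal c :=
    le_antisymm ((iInf₂_le π hπ).trans hcost.le) (le_iInf₂ hle)
  have hmin : min 1 (1 / (2 : ℝ)) = 1 / 2 := by norm_num
  rw [wassersteinDist, hinf, hmin, ENNReal.ofReal_rpow_of_nonneg hc (by norm_num),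
    Real.sqrt_eq_rpow]

section Covariance

variable {Ω : Type*} [MeasurableSpace Ω] {P : Measure Ω} [IsProbabilityMeasure P] {U V : Ω → ℝ}

lemma sq_covariance_le_variance_mul_variance (hU : MemLp U 2 P) (hV : MemLp V 2 P) :
    cov[U, V; P] ^ 2 ≤ Var[U; P] * Var[V; P] := by
  have nonneg (c : ℝ) : 0 ≤ Var[U; P] * (c * c) + (-2 * cov[U, V; P]) * c + Var[V; P] := by
    have h := variance_nonneg (c • U - V) P
    rw [variance_sub (hU.const_smul c) hV, variance_smul, covariance_smul_left] at h
    linarith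
  have h := discrim_le_zero nonneg
  rw [discrim] at h
  linarith

lemma sq_sqrt_variance_sub_le_variance_sub (hU : MemLp U 2 P) (hV : MemLp V 2 P) :
    (√Var[U; P] - √Var[V; P]) ^ 2 ≤ Var[U - V; P] := by
  have hcov : cov[U, V; P] ≤ √Var[U; P] * √Var[V; P] := by
    rw [← Real.sqrt_mul (variance_nonneg U P)]
    exact Real.le_sqrt_of_sq_le (sq_covariance_le_variance_mul_variance hU hV)
  rw [variance_sub hU hV, sub_sq, Real.sq_sqrt (variance_nonneg U P),
    Real.sq_sqrt (variance_nonneg V P)]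
  linarith

lemma sq_integral_sub_add_sq_sqrt_variance_sub_le (hU : MemLp U 2 P) (hV : MemLp V 2 P) :
    (P[U] - P[V]) ^ 2 + (√Var[U; P] - √Var[V; P]) ^ 2 ≤ ∫ ω, (U ω - V ω) ^ 2 ∂P := by
  have hvar := variance_eq_sub (hU.sub hV)
  have hmean : P[U - V] = P[U] - P[V] :=
    integral_sub (hU.integrable one_le_two) (hV.integrable one_le_two)
  have hsq : P[(U - V) ^ 2] = ∫ ω, (U ω - V ω) ^ 2 ∂P := rfl
  rw [hmean, hsq] at hvar
  linarith [sq_sqrt_variance_sub_le_variance_sub hU hV]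

end Covariance

variable {E κ : Type*} [NormedAddCommGroup E] [InnerProductSpace ℝ E] [Fintype κ] {w : κ → E}
  [MeasurableSpace E]

lemma IsParsevalFrame.lintegral_edist_sq (hw : IsParsevalFrame w) {π : Measure (E × E)}
    (h : MemLp (fun z => z.1 - z.2) 2 π) :
    ∫⁻ z, edist z.1 z.2 ^ (2 : ℝ) ∂π
      = ENNReal.ofReal (∑ k, ∫ z, inner ℝ (w k) (z.1 - z.2) ^ 2 ∂π) := by
  have hint (k : κ) : Integrable (fun z : E × E => inner ℝ (w k) (z.1 - z.2) ^ 2) π :=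
    (h.const_inner (w k)).integrable_sq
  rw [← integral_finsetSum _ (fun k _ => hint k),
    ofReal_integral_eq_lintegral_ofReal (integrable_finsetSum _ fun k _ => hint k)
      (Filter.Eventually.of_forall fun z => Finset.sum_nonneg fun k _ => sq_nonneg _)]
  refine lintegral_congr fun z => ?_
  rw [edist_dist, ENNReal.ofReal_rpow_of_nonneg dist_nonneg (by norm_num), dist_eq_norm,
    Real.rpow_two, ← hw.sum_sq_inner]

lemma IsParsevalFrame.ofReal_le_lintegral_edist_sq (hw : IsParsevalFrame w) [BorelSpace E]
    {μ ν : Measure E} [IsProbabilityMeasure μ] (hμ : MemLp id 2 μ) (hν : MemLp id 2 ν)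
    {π : Measure (E × E)} (hπ : π ∈ couplings μ ν) :
    ENNReal.ofReal (∑ k, ((∫ x, inner ℝ (w k) x ∂μ - ∫ x, inner ℝ (w k) x ∂ν) ^ 2
        + (√Var[fun x => inner ℝ (w k) x; μ] - √Var[fun x => inner ℝ (w k) x; ν]) ^ 2))
      ≤ ∫⁻ z, edist z.1 z.2 ^ (2 : ℝ) ∂π := by
  obtain ⟨rfl, rfl⟩ := hπ
  have : IsProbabilityMeasure π := Measure.isProbabilityMeasure_of_map Prod.fst
  have hfst : MemLp (fun z : E × E => z.1) 2 π := hμ.comp_of_map measurable_fst.aemeasurable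
  have hsnd : MemLp (fun z : E × E => z.2) 2 π := hν.comp_of_map measurable_snd.aemeasurable
  rw [hw.lintegral_edist_sq (hfst.sub hsnd)]
  refine ENNReal.ofReal_le_ofReal (Finset.sum_le_sum fun k _ => ?_)
  rw [integral_map (by fun_prop) (by fun_prop), integral_map (by fun_prop) (by fun_prop),
    variance_map (by fun_prop) (by fun_prop), variance_map (by fun_prop) (by fun_prop)]
  simp only [inner_sub_right]
  exact sq_integral_sub_add_sq_sqrt_variance_sub_le (hfst.const_inner (w k))
    (hsnd.const_inner (w k))

variable [BorelSpace E] [FiniteDimensional ℝ E]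

/-- The Gaussian measure with mean `a` and covariance operator `R ∘ R†`, presented as the
image of the standard Gaussian measure under `z ↦ a + R z`. -/
noncomputable def affineGaussian (a : E) (R : E →L[ℝ] E) : Measure E :=
  (stdGaussian E).map (fun z => a + R z)

instance (a : E) (R : E →L[ℝ] E) : IsGaussian (affineGaussian a R) := by
  have : affineGaussian a R = ((stdGaussian E).map R).map (fun z => a + z) := by
    rw [Measure.map_map (by fun_prop) (by fun_prop)]; rfl
  rw [this]
  infer_instance

lemma charFun_affineGaussian (a : E) (R : E →L[ℝ] E) (ξ : E) :
    charFun (affineGaussian a R) ξ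
      = Complex.exp (inner ℝ a ξ * Complex.I) * Complex.exp (-(‖R.adjoint ξ‖ ^ 2 : ℝ) / 2) := by
  have h := charFun_stdGaussian (R.adjoint ξ)
  rw [charFun_apply] at h
  rw [charFun_apply, affineGaussian, integral_map (by fun_prop) (by fun_prop)]
  simp only [inner_add_left, ← ContinuousLinearMap.adjoint_inner_right, Complex.ofReal_add,
    add_mul, Complex.exp_add]
  rw [integral_const_mul, h, Complex.ofReal_pow]

lemma integral_inner_affineGaussian (a : E) (R : E →L[ℝ] E) (ξ : E) :
    ∫ y, inner ℝ ξ y ∂affineGaussian a R = inner ℝ ξ a := by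
  have hint : Integrable (fun z => inner ℝ (R.adjoint ξ) z) (stdGaussian E) :=
    (IsGaussian.memLp_two_id.const_inner (R.adjoint ξ)).integrable one_le_two
  have hmean : ∫ z, inner ℝ (R.adjoint ξ) z ∂stdGaussian E = 0 :=
    integral_strongDual_stdGaussian (innerSL ℝ (R.adjoint ξ))
  rw [affineGaussian, integral_map (by fun_prop) (by fun_prop)]
  simp_rw [inner_add_right, ← ContinuousLinearMap.adjoint_inner_left]
  rw [integral_add (integrable_const _) hint, hmean]
  simp

lemma variance_inner_stdGaussian (ξ : E) : Var[fun z => inner ℝ ξ z; stdGaussian E] = ‖ξ‖ ^ 2 := by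
  simpa using variance_dual_stdGaussian (innerSL ℝ ξ)

lemma variance_inner_affineGaussian (a : E) (R : E →L[ℝ] E) (ξ : E) :
    Var[fun y => inner ℝ ξ y; affineGaussian a R] = ‖R.adjoint ξ‖ ^ 2 := by
  rw [affineGaussian, variance_map (by fun_prop) (by fun_prop)]
  simp only [Function.comp_def, inner_add_right, ← ContinuousLinearMap.adjoint_inner_left]
  rw [variance_const_add (by fun_prop), variance_inner_stdGaussian]

lemma integral_inner_sq_affineGaussian (a : E) (R : E →L[ℝ] E) (ξ : E) :
    ∫ y, inner ℝ ξ y ^ 2 ∂affineGaussian a R = inner ℝ ξ a ^ 2 + ‖R.adjoint ξ‖ ^ 2 := by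
  have h := variance_eq_sub
    ((IsGaussian.memLp_two_id (μ := affineGaussian a R)).const_inner ξ)
  simp only [id, Pi.pow_apply, integral_inner_affineGaussian, variance_inner_affineGaussian] at h
  linarith

/-- The coupling of two Gaussian measures driven by the same standard Gaussian vector. -/
noncomputable def synchronousCoupling (a b : E) (R Q : E →L[ℝ] E) : Measure (E × E) :=
  (stdGaussian E).map (fun z => (a + R z, b + Q z))

lemma synchronousCoupling_mem_couplings (a b : E) (R Q : E →L[ℝ] E) :
    synchronousCoupling a b R Q ∈ couplings (affineGaussian a R) (affineGaussian b Q) := by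
  constructor <;> rw [synchronousCoupling, Measure.map_map (by fun_prop) (by fun_prop)] <;> rfl

lemma map_sub_synchronousCoupling (a b : E) (R Q : E →L[ℝ] E) :
    (synchronousCoupling a b R Q).map (fun z => z.1 - z.2) = affineGaussian (a - b) (R - Q) := by
  rw [synchronousCoupling, affineGaussian, Measure.map_map (by fun_prop) (by fun_prop)]
  congr 1 with z
  simp only [Function.comp_apply, _root_.sub_apply]
  abel

lemma IsParsevalFrame.lintegral_edist_sq_synchronousCoupling (hw : IsParsevalFrame w) (a b : E)
    (R Q : E →L[ℝ] E) :
    ∫⁻ z, edist z.1 z.2 ^ (2 : ℝ) ∂synchronousCoupling a b R Q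
      = ENNReal.ofReal (∑ k, (inner ℝ (w k) (a - b) ^ 2 + ‖(R - Q).adjoint (w k)‖ ^ 2)) := by
  have hlaw := map_sub_synchronousCoupling a b R Q
  have hmem : MemLp (fun z : E × E => z.1 - z.2) 2 (synchronousCoupling a b R Q) := by
    refine MemLp.comp_of_map (g := id) ?_ (by fun_prop)
    rw [hlaw]
    exact IsGaussian.memLp_two_id
  rw [hw.lintegral_edist_sq hmem]
  simp_rw [← integral_inner_sq_affineGaussian, ← hlaw]
  congr 2 with k
  rw [integral_map (by fun_prop) (by fun_prop)]

/-- The lower bound on the cost is attained by the synchronous coupling because `R` and `Q` are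
nonnegative multiples of the identity on each frame vector. -/
theorem IsParsevalFrame.wassersteinDist_affineGaussian (hw : IsParsevalFrame w) (a b : E)
    {R Q : E →L[ℝ] E} {σ τ : κ → ℝ} (hσ : ∀ k, 0 ≤ σ k) (hτ : ∀ k, 0 ≤ τ k)
    (hR : ∀ k, R.adjoint (w k) = σ k • w k) (hQ : ∀ k, Q.adjoint (w k) = τ k • w k) :
    wassersteinDist 2 (affineGaussian a R) (affineGaussian b Q)
      = ENNReal.ofReal √(‖a - b‖ ^ 2 + ∑ k, ‖w k‖ ^ 2 * (σ k - τ k) ^ 2) := by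
  rw [← hw.sum_sq_inner, ← Finset.sum_add_distrib]
  refine wassersteinDist_two_eq_ofReal_sqrt (by positivity)
    (synchronousCoupling_mem_couplings a b R Q) ?_ fun ρ hρ => ?_
  · rw [hw.lintegral_edist_sq_synchronousCoupling]
    simp only [map_sub, _root_.sub_apply, hR, hQ, ← sub_smul, norm_smul, mul_pow,
      Real.norm_eq_abs, sq_abs, mul_comm]
  · have h := hw.ofReal_le_lintegral_edist_sq IsGaussian.memLp_two_id IsGaussian.memLp_two_id hρ
    simp only [integral_inner_affineGaussian, variance_inner_affineGaussian, hR, hQ,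
      Real.sqrt_sq (norm_nonneg _), ← inner_sub_right] at h
    simp only [norm_smul, Real.norm_of_nonneg (hσ _), Real.norm_of_nonneg (hτ _), ← sub_mul] at h
    simpa only [mul_pow, mul_comm] using h

end Wasserstein

section WienerIntegral

open Filter Topology

/-- The `k`-th point of the partition of `[0, T]` into `n + 1` intervals of equal length. -/
noncomputable def uniformPartition (T : ℝ≥0) (n k : ℕ) : ℝ≥0 := T * k / (n + 1)

lemma uniformPartition_zero (T : ℝ≥0) (n : ℕ) : uniformPartition T n 0 = 0 := by
  simp [uniformPartition]

lemma uniformPartition_last (T : ℝ≥0) (n : ℕ) : uniformPartition T n (n + 1) = T := by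
  simp [uniformPartition]

lemma monotone_uniformPartition (T : ℝ≥0) (n : ℕ) : Monotone (uniformPartition T n) := by
  intro i j hij
  unfold uniformPartition
  gcongr

lemma uniformPartition_succ_sub (T : ℝ≥0) (n k : ℕ) :
    (uniformPartition T n (k + 1) : ℝ) - uniformPartition T n k = T / (n + 1) := by
  simp only [uniformPartition]
  push_cast
  ring

lemma norm_sum_integral_sub_integral_le {t : ℕ → ℝ} (ht : Monotone t) {f : ℕ → ℝ → ℝ} {F : ℝ → ℝ}
    (hf : ∀ k, Continuous (f k)) (hF : Continuous F) {n : ℕ} {ε : ℝ}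
    (h : ∀ k < n, ∀ s ∈ Set.Icc (t k) (t (k + 1)), ‖f k s - F s‖ ≤ ε) :
    ‖(∑ k ∈ Finset.range n, ∫ s in t k..t (k + 1), f k s) - ∫ s in t 0..t n, F s‖
      ≤ ε * (t n - t 0) := by
  rw [← intervalIntegral.sum_integral_adjacent_intervals fun k _ => hF.intervalIntegrable _ _,
    ← Finset.sum_sub_distrib, ← Finset.sum_range_sub, Finset.mul_sum]
  refine norm_sum_le_of_le _ fun k hk => ?_
  have hle : t k ≤ t (k + 1) := ht k.le_succ
  rw [← intervalIntegral.integral_sub ((hf k).intervalIntegrable _ _)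
    (hF.intervalIntegrable _ _), ← abs_of_nonneg (sub_nonneg.2 hle)]
  refine intervalIntegral.norm_integral_le_of_norm_le_const fun s hs => ?_
  rw [Set.uIoc_of_le hle] at hs
  exact h k (Finset.mem_range.1 hk) s (Set.Ioc_subset_Icc_self hs)

lemma eventually_dist_uniformPartition_lt (T : ℝ≥0) {δ : ℝ} (hδ : 0 < δ) :
    ∀ᶠ n in atTop, ∀ k, ∀ r ∈ Set.Icc (uniformPartition T n k : ℝ) (uniformPartition T n (k + 1)),
      ∀ s ∈ Set.Icc (uniformPartition T n k : ℝ) (uniformPartition T n (k + 1)), dist r s < δ := by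
  have hmesh : Tendsto (fun n : ℕ => (T : ℝ) / (n + 1)) atTop (𝓝 0) :=
    tendsto_const_nhds.div_atTop (tendsto_natCast_atTop_atTop.atTop_add tendsto_const_nhds)
  filter_upwards [hmesh.eventually (gt_mem_nhds hδ)] with n hn k r hr s hs
  rw [← uniformPartition_succ_sub T n k] at hn
  exact (Real.dist_le_of_mem_Icc hr hs).trans_lt hn

lemma tendsto_sum_integral_tagged {K : ℝ → ℝ → ℝ} (hK : Continuous (Function.uncurry K))
    (T : ℝ≥0) {c : ℕ → ℕ → ℝ≥0}
    (hc : ∀ n k, c n k ∈ Set.Icc (uniformPartition T n k) (uniformPartition T n (k + 1))) :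
    Tendsto (fun n => ∑ k ∈ Finset.range (n + 1),
        ∫ s in (uniformPartition T n k : ℝ)..uniformPartition T n (k + 1), K s (c n k))
      atTop (𝓝 (∫ s in (0 : ℝ)..T, K s s)) := by
  have huc := (isCompact_Icc.prod isCompact_Icc).uniformContinuousOn_of_continuous
    (s := Set.Icc 0 (T : ℝ) ×ˢ Set.Icc 0 (T : ℝ)) hK.continuousOn
  rw [Metric.tendsto_nhds]
  intro ε hε
  obtain ⟨δ, hδ, huc⟩ := Metric.uniformContinuousOn_iff.1 huc (ε / (T + 1)) (by positivity)
  filter_upwards [eventually_dist_uniformPartition_lt T hδ] with n hmesh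
  have hclose : ∀ k < n + 1,
      ∀ s ∈ Set.Icc (uniformPartition T n k : ℝ) (uniformPartition T n (k + 1)),
        ‖K s (c n k) - K s s‖ ≤ ε / (T + 1) := by
    intro k hk s hs
    have hlast : (uniformPartition T n (k + 1) : ℝ) ≤ T := by
      exact_mod_cast (monotone_uniformPartition T n hk).trans_eq (uniformPartition_last T n)
    have hck : (c n k : ℝ) ∈ Set.Icc (uniformPartition T n k : ℝ) (uniformPartition T n (k + 1)) :=
      ⟨by exact_mod_cast (hc n k).1, by exact_mod_cast (hc n k).2⟩
    have hsub := Set.Icc_subset_Icc (uniformPartition T n k).coe_nonneg hlast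
    rw [← dist_eq_norm]
    refine (huc (s, c n k) ⟨hsub hs, hsub hck⟩ (s, s) ⟨hsub hs, hsub hs⟩ ?_).le
    rw [Prod.dist_eq, dist_self, max_lt_iff]
    exact ⟨hδ, hmesh k _ hck _ hs⟩
  have h := norm_sum_integral_sub_integral_le
    (NNReal.coe_mono.comp (monotone_uniformPartition T n))
    (f := fun k s => K s (c n k)) (F := fun s => K s s) (fun k => by fun_prop) (by fun_prop) hclose
  simp only [Function.comp_apply, uniformPartition_zero, uniformPartition_last, NNReal.coe_zero,
    sub_zero] at h
  refine h.trans_lt ?_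
  rw [div_mul_eq_mul_div, div_lt_iff₀ (by positivity)]
  linarith

lemma tendsto_sum_left_endpoints {f : ℝ → ℝ} (hf : Continuous f) (T : ℝ≥0) :
    Tendsto (fun n => ∑ k ∈ Finset.range (n + 1), f (uniformPartition T n k) *
        (uniformPartition T n (k + 1) - uniformPartition T n k))
      atTop (𝓝 (∫ s in (0 : ℝ)..T, f s)) := by
  have h := tendsto_sum_integral_tagged (K := fun _ r => f r) (by fun_prop) T
    (c := uniformPartition T) fun n k => ⟨le_rfl, monotone_uniformPartition T n k.le_succ⟩
  simpa [mul_comm] using h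

section Paths

variable {E : Type*} [NormedAddCommGroup E] [InnerProductSpace ℝ E]

/-- The Wiener integral `∫₀ᵀ ⟨g s, db s⟩` of a differentiable function `g` along a path `b`
with `b 0 = 0`, defined pathwise through integration by parts, which makes sense although `b` need
not have bounded variation. -/
noncomputable def wienerIntegral (g b : ℝ → E) (T : ℝ) : ℝ :=
  inner ℝ (g T) (b T) - ∫ s in (0 : ℝ)..T, inner ℝ (deriv g s) (b s)

lemma integral_inner_deriv_const {g : ℝ → E} (hg : ContDiff ℝ 1 g) (c : E) (r s : ℝ) :
    ∫ u in r..s, inner ℝ (deriv g u) c = inner ℝ (g s) c - inner ℝ (g r) c := by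
  have hd (u : ℝ) : HasDerivAt (fun u => inner ℝ (g u) c) (inner ℝ (deriv g u) c) u := by
    simpa using (hg.differentiable_one u).hasDerivAt.inner ℝ (hasDerivAt_const u c)
  have hcont : Continuous (deriv g) := hg.continuous_deriv_one
  exact intervalIntegral.integral_eq_sub_of_hasDerivAt (fun u _ => hd u)
    ((hcont.inner continuous_const).intervalIntegrable _ _)

lemma tendsto_sum_inner_increments {g b : ℝ → E} (hg : ContDiff ℝ 1 g) (hb : Continuous b)
    (hb0 : b 0 = 0) (T : ℝ≥0) :
    Tendsto (fun n => ∑ k ∈ Finset.range (n + 1), inner ℝ (g (uniformPartition T n k))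
        (b (uniformPartition T n (k + 1)) - b (uniformPartition T n k)))
      atTop (𝓝 (wienerIntegral g b T)) := by
  have : Continuous (deriv g) := hg.continuous_deriv_one
  have h := tendsto_sum_integral_tagged (K := fun s r => inner ℝ (deriv g s) (b r))
    (by fun_prop) T (c := fun n k => uniformPartition T n (k + 1))
    fun n k => ⟨monotone_uniformPartition T n k.le_succ, le_rfl⟩
  refine (h.const_sub (inner ℝ (g T) (b T))).congr fun n => ?_
  have telescope := Finset.sum_range_sub (fun k => inner ℝ (g (uniformPartition T n k))
    (b (uniformPartition T n k))) (n + 1)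
  simp only [uniformPartition_last, uniformPartition_zero, NNReal.coe_zero, hb0,
    inner_zero_right, sub_zero] at telescope
  rw [← telescope, ← Finset.sum_sub_distrib]
  refine Finset.sum_congr rfl fun k _ => ?_
  rw [integral_inner_deriv_const hg, inner_sub_right]
  ring

end Paths

section GaussianLimits

variable {Ω : Type*} [MeasurableSpace Ω] {P : Measure Ω}

lemma hasLaw_finsetSum_gaussianReal {ι : Type*} {Y : ι → Ω → ℝ} {a : ι → ℝ} {v : ι → ℝ≥0}
    (hY : ∀ i, HasLaw (Y i) (gaussianReal (a i) (v i)) P) (hind : iIndepFun Y P) (s : Finset ι) :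
    HasLaw (fun ω => ∑ i ∈ s, Y i ω) (gaussianReal (∑ i ∈ s, a i) (∑ i ∈ s, v i)) P := by
  classical
  have := hind.isProbabilityMeasure
  induction s using Finset.induction_on with
  | empty =>
    simp only [Finset.sum_empty, gaussianReal_zero_var]
    exact hasLaw_dirac_of_ae_eq (ae_of_all _ fun _ => rfl)
  | insert i s hi ih =>
    simp only [Finset.sum_insert hi]
    have hindep : IndepFun (Y i) (fun ω => ∑ j ∈ s, Y j ω) P :=
      (hind.indepFun_finsetSum_of_notMem₀ (fun j => (hY j).aemeasurable) hi).symm.congr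
        ae_eq_rfl (ae_of_all _ fun ω => Finset.sum_apply ω s Y)
    exact ⟨(hY i).aemeasurable.add ih.aemeasurable,
      gaussianReal_add_gaussianReal_of_indepFun hindep (hY i).map_eq ih.map_eq⟩

lemma hasLaw_gaussianReal_of_tendsto {Y : ℕ → Ω → ℝ} {Z : Ω → ℝ}
    {a : ℕ → ℝ} {a' : ℝ} {v : ℕ → ℝ≥0} {v' : ℝ≥0}
    (hY : ∀ n, HasLaw (Y n) (gaussianReal (a n) (v n)) P)
    (hYZ : ∀ᵐ ω ∂P, Tendsto (fun n => Y n ω) atTop (𝓝 (Z ω)))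
    (ha : Tendsto a atTop (𝓝 a')) (hv : Tendsto v atTop (𝓝 v')) :
    HasLaw Z (gaussianReal a' v') P := by
  have : IsProbabilityMeasure P := (hY 0).isProbabilityMeasure
  have hZ : AEMeasurable Z P :=
    aemeasurable_of_tendsto_metrizable_ae' (fun n => (hY n).aemeasurable) hYZ
  refine ⟨hZ, Measure.ext_of_charFun (funext fun ξ => ?_)⟩
  have hleft : Tendsto (fun n => charFun (P.map (Y n)) ξ) atTop (𝓝 (charFun (P.map Z) ξ)) := by
    simp only [charFun_apply_real]
    rw [integral_map hZ (by fun_prop)]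
    simp_rw [integral_map (hY _).aemeasurable
      (f := fun x : ℝ => Complex.exp (ξ * x * Complex.I)) (by fun_prop)]
    refine tendsto_integral_of_dominated_convergence (fun _ => 1)
      (fun n => ?_) (integrable_const _) (fun n => ae_of_all _ fun ω => ?_) ?_
    · have := (hY n).aemeasurable
      exact AEMeasurable.aestronglyMeasurable (by fun_prop)
    · rw [← Complex.ofReal_mul, Complex.norm_exp_ofReal_mul_I]
    · have hcont : Continuous fun x : ℝ => Complex.exp (ξ * x * Complex.I) := by fun_prop
      filter_upwards [hYZ] with ω h using (hcont.tendsto (Z ω)).comp h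
  have hright : Tendsto (fun n => charFun (gaussianReal (a n) (v n)) ξ) atTop
      (𝓝 (charFun (gaussianReal a' v') ξ)) := by
    simp only [charFun_gaussianReal]
    have hcont : Continuous fun p : ℝ × ℝ≥0 =>
        Complex.exp (ξ * p.1 * Complex.I - p.2 * ξ ^ 2 / 2) := by fun_prop
    simpa only [Function.comp_def] using (hcont.tendsto (a', v')).comp (ha.prodMk_nhds hv)
  simp only [(hY _).map_eq] at hleft
  exact tendsto_nhds_unique hleft hright

end GaussianLimits

section BrownianIncrements

variable {Ω : Type*} [MeasurableSpace Ω] {P : Measure Ω}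

lemma hasLaw_sum_mul_increments {β : ℝ≥0 → Ω → ℝ} (hβ : IsPreBrownianReal β P) (h : ℕ → ℝ)
    {t : ℕ → ℝ≥0} (ht : Monotone t) (n : ℕ) :
    HasLaw (fun ω => ∑ k ∈ Finset.range n, h k * (β (t (k + 1)) ω - β (t k) ω))
      (gaussianReal 0 (∑ k ∈ Finset.range n, ‖h k‖₊ ^ 2 * (t (k + 1) - t k))) P := by
  have hincr (k : ℕ) : HasLaw (fun ω => h k * (β (t (k + 1)) ω - β (t k) ω))
      (gaussianReal 0 (‖h k‖₊ ^ 2 * (t (k + 1) - t k))) P := by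
    have hvar : NNReal.mk (h k ^ 2) (sq_nonneg _) * nndist (t (k + 1) : ℝ) (t k)
        = ‖h k‖₊ ^ 2 * (t (k + 1) - t k) := by
      ext
      rw [NNReal.coe_mul, NNReal.coe_mul, NNReal.coe_sub (ht k.le_succ), coe_nndist, Real.dist_eq,
        abs_of_nonneg (sub_nonneg.2 (NNReal.coe_le_coe.2 (ht k.le_succ)))]
      simp
    have hlaw : HasLaw (fun ω => β (t (k + 1)) ω - β (t k) ω)
        (gaussianReal 0 (nndist (t (k + 1) : ℝ) (t k))) P := hβ.hasLaw_sub (t (k + 1)) (t k)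
    simpa only [mul_zero, hvar] using gaussianReal_const_mul hlaw (h k)
  have hind : iIndepFun (fun k ω => h k * (β (t (k + 1)) ω - β (t k) ω)) P :=
    (hβ.hasIndepIncrements.nat ht).comp (fun k x => h k * x) fun k => by fun_prop
  simpa using hasLaw_finsetSum_gaussianReal hincr hind (Finset.range n)

variable {m : ℕ} {B : ℝ≥0 → Ω → EuclideanSpace ℝ (Fin m)}

lemma IsStandardBrownianMotion.ae_continuous (hB : IsStandardBrownianMotion B P) :
    ∀ᵐ ω ∂P, Continuous fun t => B t ω := by
  filter_upwards [ae_all_iff.2 fun i => (hB.isBrownianReal i).cont] with ω h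
  exact (PiLp.continuous_toLp 2 _).comp (continuous_pi h)

lemma IsStandardBrownianMotion.ae_zero (hB : IsStandardBrownianMotion B P) :
    ∀ᵐ ω ∂P, B 0 ω = 0 := by
  filter_upwards [ae_all_iff.2 fun i => (hB.isBrownianReal i).eval_zero_ae_eq_zero] with ω h
  ext i
  exact h i

lemma IsStandardBrownianMotion.hasLaw_sum_inner_increments (hB : IsStandardBrownianMotion B P)
    (h : ℕ → EuclideanSpace ℝ (Fin m)) {t : ℕ → ℝ≥0} (ht : Monotone t) (n : ℕ) :
    HasLaw (fun ω => ∑ k ∈ Finset.range n, inner ℝ (h k) (B (t (k + 1)) ω - B (t k) ω))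
      (gaussianReal 0 (∑ k ∈ Finset.range n, ‖h k‖₊ ^ 2 * (t (k + 1) - t k))) P := by
  have hcoord : ∀ i, HasLaw
      (fun ω => ∑ k ∈ Finset.range n, h k i * (B (t (k + 1)) ω i - B (t k) ω i))
      (gaussianReal 0 (∑ k ∈ Finset.range n, ‖h k i‖₊ ^ 2 * (t (k + 1) - t k))) P := fun i =>
    hasLaw_sum_mul_increments (hB.isBrownianReal i).toIsPreBrownianReal (fun k => h k i) ht n
  have hind : iIndepFun (fun (i : Fin m) (ω : Ω) =>
      ∑ k ∈ Finset.range n, h k i * (B (t (k + 1)) ω i - B (t k) ω i)) P :=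
    hB.indep.comp (fun i b => ∑ k ∈ Finset.range n, h k i * (b (t (k + 1)) - b (t k)))
      fun i => by fun_prop
  convert hasLaw_finsetSum_gaussianReal hcoord hind Finset.univ using 2
  · rw [Finset.sum_comm]
    simp [PiLp.inner_apply, mul_comm]
  · simp
  · rw [Finset.sum_comm]
    refine Finset.sum_congr rfl fun k _ => ?_
    rw [← Finset.sum_mul, EuclideanSpace.nnnorm_eq, NNReal.sq_sqrt]

theorem IsStandardBrownianMotion.hasLaw_wienerIntegral (hB : IsStandardBrownianMotion B P)
    {g : ℝ → EuclideanSpace ℝ (Fin m)} (hg : ContDiff ℝ 1 g) (T : ℝ≥0) :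
    HasLaw (fun ω => wienerIntegral g (fun s => B s.toNNReal ω) T)
      (gaussianReal 0 (∫ s in (0 : ℝ)..T, ‖g s‖ ^ 2).toNNReal) P := by
  refine hasLaw_gaussianReal_of_tendsto
    (fun n => hB.hasLaw_sum_inner_increments (fun k => g (uniformPartition T n k))
      (monotone_uniformPartition T n) (n + 1)) ?_ tendsto_const_nhds ?_
  · filter_upwards [hB.ae_continuous, hB.ae_zero] with ω hcont hzero
    have hb : Continuous fun s : ℝ => B s.toNNReal ω := hcont.comp continuous_real_toNNReal
    simpa using tendsto_sum_inner_increments hg hb (by simpa using hzero) T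
  · have h := tendsto_real_toNNReal
      (tendsto_sum_left_endpoints (f := fun s => ‖g s‖ ^ 2) (hg.continuous.norm.pow 2) T)
    refine h.congr fun n => ?_
    rw [← Real.toNNReal_coe (r := ∑ k ∈ Finset.range (n + 1), _)]
    congr 1
    push_cast [NNReal.coe_sub (monotone_uniformPartition T n (Nat.le_succ _))]
    rfl

end BrownianIncrements

end WienerIntegral

section LinearFlow

open NormedSpace

variable {E F : Type*} [NormedAddCommGroup E] [InnerProductSpace ℝ E] [CompleteSpace E]
  [NormedAddCommGroup F] [InnerProductSpace ℝ F] [CompleteSpace F]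

lemma hasDerivAt_exp_sub_smul_apply (L : E →L[ℝ] E) (ξ : E) (T s : ℝ) :
    HasDerivAt (fun r => exp ((r - T) • L) ξ) (L (exp ((s - T) • L) ξ)) s := by
  have h := (hasDerivAt_exp_smul_const' (𝕂 := ℝ) L (s - T)).comp_sub_const s T
  simpa using h.clm_apply (hasDerivAt_const s ξ)

lemma contDiff_exp_sub_smul_apply (L : E →L[ℝ] E) (ξ : E) (T : ℝ) :
    ContDiff ℝ 1 fun r => exp ((r - T) • L) ξ := by
  have hd := hasDerivAt_exp_sub_smul_apply L ξ T
  have hcont := continuous_iff_continuousAt.2 fun s => (hd s).continuousAt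
  refine contDiff_one_iff_deriv.2 ⟨fun s => (hd s).differentiableAt, ?_⟩
  rw [funext fun s => (hd s).deriv]
  exact L.continuous.comp hcont

lemma adjoint_exp_smul (L : E →L[ℝ] E) (r : ℝ) :
    (exp (r • L)).adjoint = exp (r • star L) := by
  rw [← ContinuousLinearMap.star_eq_adjoint, star_exp, star_smul, star_trivial (R := ℝ)]

/-- Variation of constants, tested against a vector `ξ`. -/
lemma inner_eq_add_wienerIntegral_of_integral_eq {L : E →L[ℝ] E} {f b : ℝ → E}
    (hf : Continuous f) {x : E} {T : ℝ} (hT : 0 ≤ T)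
    (hsol : ∀ t, 0 ≤ t → f t = x - (∫ s in (0 : ℝ)..t, L (f s)) + b t) (ξ : E) :
    inner ℝ ξ (f T) = inner ℝ ξ (exp ((-T) • L) x)
      + wienerIntegral (fun s => exp ((s - T) • star L) ξ) b T := by
  set g : ℝ → E := fun s => exp ((s - T) • star L) ξ with hg
  have hgd : ∀ s, HasDerivAt g (star L (g s)) s := hasDerivAt_exp_sub_smul_apply (star L) ξ T
  have hgc : Continuous g := (contDiff_exp_sub_smul_apply (star L) ξ T).continuous
  set Y : ℝ → E := fun t => x - ∫ s in (0 : ℝ)..t, L (f s) with hY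
  have hLf : Continuous fun s => L (f s) := L.continuous.comp hf
  have hYd : ∀ s, HasDerivAt Y (-L (f s)) s := fun s =>
    (hLf.integral_hasStrictDerivAt 0 s).hasDerivAt.const_sub x
  have hYc : Continuous Y := continuous_iff_continuousAt.2 fun s => (hYd s).continuousAt
  have hparts := intervalIntegral.integral_eq_sub_of_hasDerivAt (a := 0) (b := T)
    (fun s _ => (hgd s).inner ℝ (hYd s))
    (by apply Continuous.intervalIntegrable; fun_prop)
  have hintegrand : ∫ s in (0 : ℝ)..T, (inner ℝ (g s) (-L (f s)) + inner ℝ (star L (g s)) (Y s))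
      = -∫ s in (0 : ℝ)..T, inner ℝ (deriv g s) (b s) := by
    rw [← intervalIntegral.integral_neg]
    refine intervalIntegral.integral_congr fun s hs => ?_
    rw [Set.uIcc_of_le hT] at hs
    have hfs : f s = Y s + b s := hsol s hs.1
    have hadj : inner ℝ (g s) (L (f s)) = inner ℝ (star L (g s)) (f s) := by
      rw [ContinuousLinearMap.star_eq_adjoint, ContinuousLinearMap.adjoint_inner_left]
    simp only [inner_neg_right, hadj, (hgd s).deriv]
    rw [hfs, inner_add_right]
    ring
  have hstart : inner ℝ (g 0) (Y 0) = inner ℝ ξ (exp ((-T) • L) x) := by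
    rw [← ContinuousLinearMap.adjoint_inner_left, adjoint_exp_smul]
    simp [hg, hY]
  have hgT : g T = ξ := by simp [hg]
  rw [hintegrand, hstart, hgT] at hparts
  rw [wienerIntegral, hgT, show f T = Y T + b T from hsol T hT, inner_add_right]
  linarith

lemma wienerIntegral_clm_comp (S : F →L[ℝ] E) {g : ℝ → E} (hg : Differentiable ℝ g) (b : ℝ → F)
    (T : ℝ) :
    wienerIntegral g (fun s => S (b s)) T = wienerIntegral (fun s => S.adjoint (g s)) b T := by
  have hd (s : ℝ) : deriv (fun s => S.adjoint (g s)) s = S.adjoint (deriv g s) :=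
    (S.adjoint.hasFDerivAt.comp_hasDerivAt s (hg s).hasDerivAt).deriv
  simp only [wienerIntegral, hd, ContinuousLinearMap.adjoint_inner_left]

/-- The variance at time `T` of the component in direction `ξ` of the solution of
`dX = -L X dt + S dB`. -/
noncomputable def ouVariance (L : E →L[ℝ] E) (S : F →L[ℝ] E) (T : ℝ) (ξ : E) : ℝ :=
  ∫ s in (0 : ℝ)..T, ‖S.adjoint (exp ((s - T) • star L) ξ)‖ ^ 2

lemma ouVariance_nonneg (L : E →L[ℝ] E) (S : F →L[ℝ] E) {T : ℝ} (hT : 0 ≤ T) (ξ : E) :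
    0 ≤ ouVariance L S T ξ :=
  intervalIntegral.integral_nonneg hT fun _ _ => by positivity

end LinearFlow

section OrnsteinUhlenbeck

open Filter Topology NormedSpace

variable {Ω : Type*} [MeasurableSpace Ω] {P : Measure Ω} {m n : ℕ}
  {A : Matrix (Fin m) (Fin m) ℝ} {σ : Matrix (Fin m) (Fin n) ℝ}
  {B : ℝ≥0 → Ω → EuclideanSpace ℝ (Fin n)}

section Law

variable {x : EuclideanSpace ℝ (Fin m)} {X : ℝ≥0 → Ω → EuclideanSpace ℝ (Fin m)}

lemma IsOrnsteinUhlenbeck.ae_inner_eq (hX : IsOrnsteinUhlenbeck A σ B P x X) (T : ℝ≥0)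
    (ξ : EuclideanSpace ℝ (Fin m)) :
    ∀ᵐ ω ∂P, inner ℝ ξ (X T ω)
      = inner ℝ ξ (exp ((-T : ℝ) • Matrix.toEuclideanCLM (𝕜 := ℝ) A) x)
        + wienerIntegral (fun s => (Matrix.toEuclideanLin σ).toContinuousLinearMap.adjoint
            (exp ((s - T) • star (Matrix.toEuclideanCLM (𝕜 := ℝ) A)) ξ))
          (fun s => B s.toNNReal ω) T := by
  filter_upwards [hX] with ω ⟨hcont, hsol⟩
  have h := inner_eq_add_wienerIntegral_of_integral_eq
    (L := Matrix.toEuclideanCLM (𝕜 := ℝ) A) (x := x) (f := fun s => X s.toNNReal ω)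
    (b := fun s => (Matrix.toEuclideanLin σ).toContinuousLinearMap (B s.toNNReal ω))
    (hcont.comp continuous_real_toNNReal) T.coe_nonneg (fun t ht => ?_) ξ
  · rwa [Real.toNNReal_coe, wienerIntegral_clm_comp _
      ((contDiff_exp_sub_smul_apply _ ξ T).differentiable one_ne_zero)] at h
  · have ht' := hsol t.toNNReal
    rwa [Real.coe_toNNReal t ht] at ht'

lemma IsOrnsteinUhlenbeck.hasLaw_inner (hX : IsOrnsteinUhlenbeck A σ B P x X)
    (hB : IsStandardBrownianMotion B P) (T : ℝ≥0) (ξ : EuclideanSpace ℝ (Fin m)) :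
    HasLaw (fun ω => inner ℝ ξ (X T ω))
      (gaussianReal (inner ℝ ξ (exp ((-T : ℝ) • Matrix.toEuclideanCLM (𝕜 := ℝ) A) x))
        (ouVariance (Matrix.toEuclideanCLM (𝕜 := ℝ) A)
          (Matrix.toEuclideanLin σ).toContinuousLinearMap T ξ).toNNReal) P := by
  have hW := hB.hasLaw_wienerIntegral (T := T)
    ((Matrix.toEuclideanLin σ).toContinuousLinearMap.adjoint.contDiff.comp
      (contDiff_exp_sub_smul_apply (star (Matrix.toEuclideanCLM (𝕜 := ℝ) A)) ξ T))
  have h := (gaussianReal_const_add hW _).congr (hX.ae_inner_eq T ξ)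
  rwa [zero_add] at h

lemma IsOrnsteinUhlenbeck.aemeasurable (hX : IsOrnsteinUhlenbeck A σ B P x X)
    (hB : IsStandardBrownianMotion B P) (T : ℝ≥0) : AEMeasurable (X T) P := by
  have hcoord : AEMeasurable (fun ω i => X T ω i) P := aemeasurable_pi_lambda _ fun i => by
    simpa [EuclideanSpace.inner_single_left] using
      (hX.hasLaw_inner hB T (EuclideanSpace.single i 1)).aemeasurable
  exact (WithLp.measurable_toLp 2 _).comp_aemeasurable hcoord

theorem IsOrnsteinUhlenbeck.charFun_map (hX : IsOrnsteinUhlenbeck A σ B P x X)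
    (hB : IsStandardBrownianMotion B P) (T : ℝ≥0) (ξ : EuclideanSpace ℝ (Fin m)) :
    charFun (P.map (X T)) ξ
      = Complex.exp (inner ℝ (exp ((-T : ℝ) • Matrix.toEuclideanCLM (𝕜 := ℝ) A) x) ξ * Complex.I)
        * Complex.exp (-(ouVariance (Matrix.toEuclideanCLM (𝕜 := ℝ) A)
            (Matrix.toEuclideanLin σ).toContinuousLinearMap T ξ) / 2) := by
  have hlaw := hX.hasLaw_inner hB T ξ
  have hreduce : charFun (P.map (X T)) ξ = charFun (P.map fun ω => inner ℝ ξ (X T ω)) 1 := by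
    rw [charFun_apply, charFun_apply_real, integral_map (hX.aemeasurable hB T) (by fun_prop),
      integral_map hlaw.aemeasurable (by fun_prop)]
    simp [real_inner_comm]
  have hcoe : ∀ {v : ℝ}, 0 ≤ v → ((v.toNNReal : ℝ≥0) : ℂ) = v := fun hv =>
    congrArg Complex.ofReal (Real.coe_toNNReal _ hv)
  rw [hreduce, hlaw.map_eq, charFun_gaussianReal, ← Complex.exp_add, real_inner_comm,
    hcoe (ouVariance_nonneg _ _ T.coe_nonneg _)]
  congr 1
  push_cast
  ring

end Law

lemma charFun_eq_mul_of_forall_lintegral {E : Type*} [NormedAddCommGroup E]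
    [InnerProductSpace ℝ E] [CompleteSpace E] [SecondCountableTopology E] [MeasurableSpace E]
    [BorelSpace E] {μ ν : Measure E} [IsFiniteMeasure μ] [IsFiniteMeasure ν] (Φ : E →L[ℝ] E)
    (h : ∀ S, MeasurableSet S → ∫⁻ x, (ν.map fun y => Φ x + y) S ∂μ = μ S) (ξ : E) :
    charFun μ ξ = charFun μ (Φ.adjoint ξ) * charFun ν ξ := by
  have hconv : μ = μ.map Φ ∗ ν := by
    ext S hS
    have hadd : Measurable fun p : E × E => p.1 + p.2 := by fun_prop
    rw [Measure.conv, Measure.map_apply hadd hS, Measure.prod_apply (hadd hS),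
      lintegral_map (measurable_measure_prodMk_left (hadd hS)) (by fun_prop), ← h S hS]
    refine lintegral_congr fun x => ?_
    rw [Measure.map_apply (by fun_prop) hS]
    rfl
  have hmap : charFun (μ.map Φ) ξ = charFun μ (Φ.adjoint ξ) := by
    rw [charFun_apply, charFun_apply, integral_map (by fun_prop) (by fun_prop)]
    simp only [ContinuousLinearMap.adjoint_inner_right]
  nth_rewrite 1 [hconv]
  rw [charFun_conv, hmap]

section Invariant

variable {X : EuclideanSpace ℝ (Fin m) → ℝ≥0 → Ω → EuclideanSpace ℝ (Fin m)}
  (hX : ∀ x, IsOrnsteinUhlenbeck A σ B P x (X x)) (hB : IsStandardBrownianMotion B P)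
include hX hB

lemma map_ornsteinUhlenbeck_eq_map_add (x : EuclideanSpace ℝ (Fin m)) (T : ℝ≥0) :
    P.map (X x T) = (P.map (X 0 T)).map
      fun y => exp ((-T : ℝ) • Matrix.toEuclideanCLM (𝕜 := ℝ) A) x + y := by
  have := hB.indep.isProbabilityMeasure
  have := Measure.isProbabilityMeasure_map ((hX x).aemeasurable hB T)
  have := Measure.isProbabilityMeasure_map ((hX 0).aemeasurable hB T)
  refine Measure.ext_of_charFun (funext fun ξ => ?_)
  rw [charFun_map_const_add, (hX x).charFun_map hB, (hX 0).charFun_map hB, map_zero,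
    inner_zero_left, Complex.ofReal_zero, zero_mul, Complex.exp_zero, one_mul, mul_comm]

/-- Invariance expresses `charFun μ ξ` through its value at `exp (-T A†) ξ` and the law of the
solution started in `0`; the limit `T → ∞` removes the first factor. -/
theorem IsInvariantDistribution.charFun_eq {μ : Measure (EuclideanSpace ℝ (Fin m))}
    (hμ : IsInvariantDistribution X P μ) {ξ : EuclideanSpace ℝ (Fin m)} {q : ℝ}
    (hflow : Tendsto
      (fun T : ℝ≥0 => exp ((-T : ℝ) • star (Matrix.toEuclideanCLM (𝕜 := ℝ) A)) ξ) atTop (𝓝 0))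
    (hvar : Tendsto (fun T : ℝ≥0 => ouVariance (Matrix.toEuclideanCLM (𝕜 := ℝ) A)
      (Matrix.toEuclideanLin σ).toContinuousLinearMap T ξ) atTop (𝓝 q)) :
    charFun μ ξ = Complex.exp (-q / 2) := by
  have := hμ.isProbabilityMeasure
  have hstep (T : ℝ≥0) : charFun μ ξ
      = charFun μ (exp ((-T : ℝ) • star (Matrix.toEuclideanCLM (𝕜 := ℝ) A)) ξ)
        * Complex.exp (-(ouVariance (Matrix.toEuclideanCLM (𝕜 := ℝ) A)
            (Matrix.toEuclideanLin σ).toContinuousLinearMap T ξ) / 2) := by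
    have := hB.indep.isProbabilityMeasure
    have := Measure.isProbabilityMeasure_map ((hX 0).aemeasurable hB T)
    rw [charFun_eq_mul_of_forall_lintegral (ν := P.map (X 0 T))
      (exp ((-T : ℝ) • Matrix.toEuclideanCLM (𝕜 := ℝ) A)) (fun S hS => ?_) ξ,
      adjoint_exp_smul, (hX 0).charFun_map hB]
    · rw [map_zero, inner_zero_left, Complex.ofReal_zero, zero_mul, Complex.exp_zero, one_mul]
    · simpa only [← map_ornsteinUhlenbeck_eq_map_add hX hB] using hμ.invariant T S hS
  have hinit : Tendsto
      (fun T : ℝ≥0 => charFun μ (exp ((-T : ℝ) • star (Matrix.toEuclideanCLM (𝕜 := ℝ) A)) ξ))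
      atTop (𝓝 1) := by
    simpa [Function.comp_def] using ((continuous_charFun (μ := μ)).tendsto 0).comp hflow
  have hexp : Continuous fun v : ℝ => Complex.exp (-(v : ℂ) / 2) := by fun_prop
  have hlim := hinit.mul ((hexp.tendsto q).comp hvar)
  rw [one_mul] at hlim
  exact tendsto_nhds_unique tendsto_const_nhds (hlim.congr fun T => (hstep T).symm)

end Invariant

end OrnsteinUhlenbeck

section NormalDrift

open NormedSpace Filter Topology

variable {E κ : Type*} [NormedAddCommGroup E] [InnerProductSpace ℝ E] [CompleteSpace E]
  [Fintype κ] {w : κ → E} {s : κ → ℝ}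

lemma exp_apply_of_eigenvector {M : E →L[ℝ] E} {u : E} {c : ℝ} (h : M u = c • u) :
    exp M u = Real.exp c • u := by
  have hpow (n : ℕ) : (M ^ n) u = c ^ n • u := by
    induction n with
    | zero => simp
    | succ n ih => rw [pow_succ', mul_apply_eq_comp, ih, map_smul, h, smul_smul, ← pow_succ]
  have hM := (exp_series_hasSum_exp' (𝕂 := ℝ) M).mapL (ContinuousLinearMap.apply ℝ E u)
  have hc := (exp_series_hasSum_exp' (𝕂 := ℝ) c).smul_const u
  rw [← Real.exp_eq_exp_ℝ] at hc
  refine hM.unique ?_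
  convert hc using 2 with n
  simp [hpow, smul_smul]

lemma IsParsevalFrame.norm_exp_smul_apply_sq (hw : IsParsevalFrame w) {N : E →L[ℝ] E}
    [IsStarNormal N] (hs : ∀ k, (selfAdjointPart ℝ N : E →L[ℝ] E) (w k) = s k • w k) (r : ℝ)
    (ξ : E) :
    ‖exp (r • N) ξ‖ ^ 2 = ∑ k, Real.exp (2 * s k * r) * inner ℝ (w k) ξ ^ 2 := by
  have hmul : star (exp (r • N)) * exp (r • N)
      = exp ((2 * r) • (selfAdjointPart ℝ N : E →L[ℝ] E)) := by
    let _ : NormedAlgebra ℚ (E →L[ℝ] E) := NormedAlgebra.restrictScalars ℚ ℝ _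
    have hcomm : Commute (r • star N) (r • N) :=
      ((show Commute (star N) N from star_comm_self).smul_left r).smul_right r
    rw [ContinuousLinearMap.star_eq_adjoint, adjoint_exp_smul, ← exp_add_of_commute hcomm,
      selfAdjointPart_apply_coe, ← smul_add,
      add_comm, mul_comm, mul_smul, smul_smul (2 : ℝ), mul_invOf_self, one_smul]
  have heigen (k : κ) : exp ((2 * r) • (selfAdjointPart ℝ N : E →L[ℝ] E)) (w k)
      = Real.exp (2 * s k * r) • w k :=
    exp_apply_of_eigenvector (by rw [_root_.smul_apply, hs, smul_smul, mul_right_comm])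
  calc ‖exp (r • N) ξ‖ ^ 2
      = inner ℝ ξ ((star (exp (r • N)) * exp (r • N)) ξ) := by
        rw [← real_inner_self_eq_norm_sq, mul_apply_eq_comp, ContinuousLinearMap.star_eq_adjoint,
          ContinuousLinearMap.adjoint_inner_right]
    _ = ∑ k, Real.exp (2 * s k * r) * inner ℝ (w k) ξ ^ 2 := by
        rw [hmul]
        nth_rewrite 2 [← hw ξ]
        simp only [map_sum, map_smul, heigen, inner_sum, inner_smul_right, real_inner_comm ξ]
        exact Finset.sum_congr rfl fun k _ => by ring

lemma selfAdjointPart_star (N : E →L[ℝ] E) : selfAdjointPart ℝ (star N) = selfAdjointPart ℝ N := by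
  ext1
  rw [selfAdjointPart_apply_coe, selfAdjointPart_apply_coe, star_star, add_comm]

lemma integral_exp_two_mul_sub {c : ℝ} (hc : c ≠ 0) (T : ℝ) :
    ∫ r in (0 : ℝ)..T, Real.exp (2 * c * (r - T)) = (1 - Real.exp (-2 * c * T)) / (2 * c) := by
  have hd (r : ℝ) : HasDerivAt (fun r => Real.exp (2 * c * (r - T)) / (2 * c))
      (Real.exp (2 * c * (r - T))) r := by
    have h := ((((hasDerivAt_id r).sub_const T).const_mul (2 * c)).exp).div_const (2 * c)
    rwa [mul_one, mul_div_cancel_right₀ _ (by simpa using hc)] at h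
  rw [intervalIntegral.integral_eq_sub_of_hasDerivAt (fun r _ => hd r)
    (by apply Continuous.intervalIntegrable; fun_prop), ← sub_div]
  simp

/-- The standard deviation at time `T` of the one-dimensional Ornstein-Uhlenbeck process with
rate `s`. -/
noncomputable def ouStd (s T : ℝ) : ℝ :=
  √((1 - Real.exp (-2 * s * T)) / (2 * s))

lemma one_sub_exp_neg_two_mul_nonneg {s T : ℝ} (hs : 0 ≤ s) (hT : 0 ≤ T) :
    0 ≤ 1 - Real.exp (-2 * s * T) :=
  sub_nonneg.2 (Real.exp_le_one_iff.2 (by nlinarith [mul_nonneg hs hT]))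

lemma ouStd_sq {s T : ℝ} (hs : 0 ≤ s) (hT : 0 ≤ T) :
    ouStd s T ^ 2 = (1 - Real.exp (-2 * s * T)) / (2 * s) :=
  Real.sq_sqrt (div_nonneg (one_sub_exp_neg_two_mul_nonneg hs hT) (by positivity))

lemma tendsto_exp_neg_two_mul_atTop {s : ℝ} (hs : 0 < s) :
    Tendsto (fun T : ℝ≥0 => Real.exp (-2 * s * T)) atTop (𝓝 0) := by
  have hcoe : Tendsto (fun T : ℝ≥0 => (T : ℝ)) atTop atTop := NNReal.tendsto_coe_atTop.2 tendsto_id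
  exact Real.tendsto_exp_atBot.comp (hcoe.const_mul_atTop_of_neg (by linarith))

lemma tendsto_ouStd_atTop {s : ℝ} (hs : 0 < s) :
    Tendsto (fun T : ℝ≥0 => ouStd s T) atTop (𝓝 √(1 / (2 * s))) := by
  have h := ((tendsto_exp_neg_two_mul_atTop hs).const_sub 1).div_const (2 * s)
  rw [sub_zero] at h
  exact h.sqrt

lemma ouStd_sub_sqrt_sq {s T : ℝ} (hs : 0 < s) (hT : 0 ≤ T) :
    (ouStd s T - √(1 / (2 * s))) ^ 2
      = 1 / (2 * s) * (Real.exp (-4 * s * T) / (√(1 - Real.exp (-2 * s * T)) + 1) ^ 2) := by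
  have hle := one_sub_exp_neg_two_mul_nonneg hs.le hT
  have hexp : Real.exp (-4 * s * T) = Real.exp (-2 * s * T) ^ 2 := by
    rw [← Real.exp_nat_mul]
    congr 1
    push_cast
    ring
  rw [ouStd, hexp, Real.sqrt_div hle, Real.sqrt_div zero_le_one, Real.sqrt_one, ← sub_div, div_pow,
    Real.sq_sqrt (by positivity)]
  set a := √(1 - Real.exp (-2 * s * T))
  have hfactor : Real.exp (-2 * s * T) = (1 - a) * (1 + a) := by
    linear_combination Real.sq_sqrt hle
  have : 0 ≤ a := Real.sqrt_nonneg _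
  rw [hfactor]
  field_simp
  ring

section Frame

variable (hw : IsParsevalFrame w) {L : E →L[ℝ] E} [IsStarNormal L]
  (hs : ∀ k, (selfAdjointPart ℝ L : E →L[ℝ] E) (w k) = s k • w k) (hs_pos : ∀ k, 0 < s k)
include hw hs hs_pos

lemma IsParsevalFrame.tendsto_exp_neg_smul_star_apply (ξ : E) :
    Tendsto (fun T : ℝ≥0 => exp ((-T : ℝ) • star L) ξ) atTop (𝓝 0) := by
  have hsq : Tendsto (fun T : ℝ≥0 => ‖exp ((-T : ℝ) • star L) ξ‖ ^ 2) atTop (𝓝 0) := by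
    have hsum : Tendsto (fun T : ℝ≥0 => ∑ k, Real.exp (-2 * s k * T) * inner ℝ (w k) ξ ^ 2) atTop
        (𝓝 (∑ k, 0 * inner ℝ (w k) ξ ^ 2)) :=
      tendsto_finsetSum _ fun k _ => (tendsto_exp_neg_two_mul_atTop (hs_pos k)).mul_const _
    simp_rw [zero_mul, Finset.sum_const_zero] at hsum
    refine hsum.congr fun T => ?_
    rw [hw.norm_exp_smul_apply_sq (selfAdjointPart_star L ▸ hs)]
    simp
  simpa [tendsto_zero_iff_norm_tendsto_zero] using hsq.sqrt

lemma IsParsevalFrame.ouVariance_id_eq {T : ℝ} (hT : 0 ≤ T) (ξ : E) :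
    ouVariance L (.id ℝ E) T ξ = ∑ k, ouStd (s k) T ^ 2 * inner ℝ (w k) ξ ^ 2 := by
  have hnorm (r : ℝ) : ‖(ContinuousLinearMap.id ℝ E).adjoint (exp ((r - T) • star L) ξ)‖ ^ 2
      = ∑ k, Real.exp (2 * s k * (r - T)) * inner ℝ (w k) ξ ^ 2 := by
    rw [← hw.norm_exp_smul_apply_sq (selfAdjointPart_star L ▸ hs),
      ContinuousLinearMap.adjoint_id, ContinuousLinearMap.id_apply]
  simp_rw [ouVariance, hnorm]
  rw [intervalIntegral.integral_finsetSum
    fun k _ => (by apply Continuous.intervalIntegrable; fun_prop)]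
  refine Finset.sum_congr rfl fun k _ => ?_
  rw [intervalIntegral.integral_mul_const, integral_exp_two_mul_sub (hs_pos k).ne',
    ouStd_sq (hs_pos k).le hT]

lemma IsParsevalFrame.ouVariance_id_eq_norm_sq {T : ℝ} (hT : 0 ≤ T) (ξ : E) :
    ouVariance L (.id ℝ E) T ξ = ‖frameMultiplier w (fun k => ouStd (s k) T) ξ‖ ^ 2 := by
  rw [hw.norm_frameMultiplier_apply_sq (selfAdjointPart ℝ L).2 hs fun r => ouStd r T,
    hw.ouVariance_id_eq hs hs_pos hT]

lemma IsParsevalFrame.tendsto_ouVariance_id (ξ : E) :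
    Tendsto (fun T : ℝ≥0 => ouVariance L (.id ℝ E) T ξ) atTop
      (𝓝 (‖frameMultiplier w (fun k => √(1 / (2 * s k))) ξ‖ ^ 2)) := by
  rw [hw.norm_frameMultiplier_apply_sq (selfAdjointPart ℝ L).2 hs fun r => √(1 / (2 * r))]
  simp_rw [hw.ouVariance_id_eq hs hs_pos (NNReal.coe_nonneg _)]
  exact tendsto_finsetSum _ fun k _ => ((tendsto_ouStd_atTop (hs_pos k)).pow 2).mul_const _

end Frame

end NormalDrift

section FrameDistance

open NormedSpace

variable {Ω κ : Type*} [MeasurableSpace Ω] {P : Measure Ω} [Fintype κ]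
  {m : ℕ} {A : Matrix (Fin m) (Fin m) ℝ} {B : ℝ≥0 → Ω → EuclideanSpace ℝ (Fin m)}
  {w : κ → EuclideanSpace ℝ (Fin m)} {s : κ → ℝ}

lemma toContinuousLinearMap_toEuclideanLin_one :
    (Matrix.toEuclideanLin (1 : Matrix (Fin m) (Fin m) ℝ)).toContinuousLinearMap = .id ℝ _ := by
  ext1 x
  simp

variable (hw : IsParsevalFrame w) [IsStarNormal (Matrix.toEuclideanCLM (𝕜 := ℝ) A)]
  (hs : ∀ k, (selfAdjointPart ℝ (Matrix.toEuclideanCLM (𝕜 := ℝ) A) :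
    EuclideanSpace ℝ (Fin m) →L[ℝ] EuclideanSpace ℝ (Fin m)) (w k) = s k • w k)
  (hs_pos : ∀ k, 0 < s k) (hB : IsStandardBrownianMotion B P)
include hw hs hs_pos hB

theorem IsOrnsteinUhlenbeck.map_eq_affineGaussian {x : EuclideanSpace ℝ (Fin m)}
    {X : ℝ≥0 → Ω → EuclideanSpace ℝ (Fin m)} (hX : IsOrnsteinUhlenbeck A 1 B P x X) (t : ℝ≥0) :
    P.map (X t) = affineGaussian (exp ((-t : ℝ) • Matrix.toEuclideanCLM (𝕜 := ℝ) A) x)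
      (frameMultiplier w fun k => ouStd (s k) t) := by
  have := hB.indep.isProbabilityMeasure
  have := Measure.isProbabilityMeasure_map (hX.aemeasurable hB t)
  refine Measure.ext_of_charFun (funext fun ξ => ?_)
  rw [hX.charFun_map hB, charFun_affineGaussian, adjoint_frameMultiplier,
    toContinuousLinearMap_toEuclideanLin_one, hw.ouVariance_id_eq_norm_sq hs hs_pos t.coe_nonneg]

variable {X : EuclideanSpace ℝ (Fin m) → ℝ≥0 → Ω → EuclideanSpace ℝ (Fin m)}
  (hX : ∀ x, IsOrnsteinUhlenbeck A 1 B P x (X x)) {μ : Measure (EuclideanSpace ℝ (Fin m))}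
  (hμ : IsInvariantDistribution X P μ)
include hX hμ

theorem IsInvariantDistribution.eq_affineGaussian :
    μ = affineGaussian 0 (frameMultiplier w fun k => √(1 / (2 * s k))) := by
  have := hμ.isProbabilityMeasure
  refine Measure.ext_of_charFun (funext fun ξ => ?_)
  rw [hμ.charFun_eq hX hB (hw.tendsto_exp_neg_smul_star_apply hs hs_pos ξ)
      (toContinuousLinearMap_toEuclideanLin_one (m := m) ▸
        hw.tendsto_ouVariance_id hs hs_pos ξ),
    charFun_affineGaussian, adjoint_frameMultiplier, inner_zero_left, Complex.ofReal_zero,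
    zero_mul, Complex.exp_zero, one_mul]

theorem IsParsevalFrame.wassersteinDist_ornsteinUhlenbeck (x : EuclideanSpace ℝ (Fin m))
    (t : ℝ≥0) :
    wassersteinDist 2 (P.map (X x t)) μ =
      ENNReal.ofReal √(∑ k, Real.exp (-2 * s k * t) * inner ℝ (w k) x ^ 2
        + ∑ k, ‖w k‖ ^ 2 * (1 / (2 * s k) * (Real.exp (-4 * s k * t) /
            (√(1 - Real.exp (-2 * s k * t)) + 1) ^ 2))) := by
  have hmult (f : ℝ → ℝ) (k : κ) :
      (frameMultiplier w fun i => f (s i)).adjoint (w k) = f (s k) • w k := by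
    rw [adjoint_frameMultiplier,
      hw.frameMultiplier_apply_self (selfAdjointPart ℝ (Matrix.toEuclideanCLM (𝕜 := ℝ) A)).2 hs]
  rw [(hX x).map_eq_affineGaussian hw hs hs_pos hB, hμ.eq_affineGaussian hw hs hs_pos hB hX,
    hw.wassersteinDist_affineGaussian _ _ (σ := fun k => ouStd (s k) t)
      (τ := fun k => √(1 / (2 * s k))) (fun _ => Real.sqrt_nonneg _) (fun _ => Real.sqrt_nonneg _)
      (hmult fun r => ouStd r t) (hmult fun r => √(1 / (2 * r))),
    sub_zero, hw.norm_exp_smul_apply_sq hs]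
  simp only [ouStd_sub_sqrt_sq (hs_pos _) t.coe_nonneg, mul_neg, neg_mul]

end FrameDistance

section Eigenvectors

open scoped ComplexConjugate

lemma sum_inner_smul_of_card_eq_finrank {𝕜 E κ : Type*} [RCLike 𝕜] [NormedAddCommGroup E]
    [InnerProductSpace 𝕜 E] [FiniteDimensional 𝕜 E] [Fintype κ] {v : κ → E}
    (hv : Orthonormal 𝕜 v) (hcard : Fintype.card κ = Module.finrank 𝕜 E) (z : E) :
    ∑ j, inner 𝕜 (v j) z • v j = z := by
  have hspan : ⊤ ≤ Submodule.span 𝕜 (Set.range v) :=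
    (hv.linearIndependent.span_eq_top_of_card_eq_finrank' hcard).ge
  simpa using (OrthonormalBasis.mk hv hspan).sum_repr' z

lemma eigenvalue_pos_of_posDef {ι : Type*} [Fintype ι] [DecidableEq ι] {A : Matrix ι ι ℝ}
    (hA : A.PosDef) {v : EuclideanSpace ℝ ι} (hv : v ≠ 0) {c : ℝ}
    (h : Matrix.toEuclideanLin A v = c • v) : 0 < c := by
  have hpos := hA.dotProduct_mulVec_pos (x := v.ofLp) (by simpa using hv)
  rw [show A.mulVec v.ofLp = c • v.ofLp from congrArg WithLp.ofLp h, dotProduct_smul,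
    smul_eq_mul] at hpos
  exact pos_of_mul_pos_left hpos (dotProduct_star_self_nonneg _)

lemma star_apply_of_isStarNormal {E : Type*} [NormedAddCommGroup E] [InnerProductSpace ℂ E]
    [CompleteSpace E] (T : E →L[ℂ] E) [IsStarNormal T] {z : E} {c : ℂ} (h : T z = c • z) :
    star T z = conj c • z := by
  have hnormal : IsStarNormal (T - c • (1 : E →L[ℂ] E)) := ⟨by
    simp only [Commute, SemiconjBy, star_sub, star_smul, star_one, sub_mul, mul_sub,
      star_comm_self' T, smul_mul_assoc, mul_smul_comm, one_mul, mul_one, smul_sub,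
      smul_comm (star c) c]
    abel⟩
  have hker := (ContinuousLinearMap.IsStarNormal.adjoint_apply_eq_zero_iff hnormal z).2
    (by simp [h])
  rw [← ContinuousLinearMap.star_eq_adjoint, star_sub, star_smul, star_one] at hker
  simpa [sub_eq_zero] using hker

variable {ι κ : Type*}

/-- A real linear functional on `ℂ`, in particular `Re` or `Im`, applied coordinatewise. -/
noncomputable def mapCoord (φ : ℂ →ₗ[ℝ] ℝ) : EuclideanSpace ℂ ι →ₗ[ℝ] EuclideanSpace ℝ ι where
  toFun z := WithLp.toLp 2 fun i => φ (z i)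
  map_add' z z' := by ext i; simp
  map_smul' r z := by ext i; simp [-Complex.real_smul]

/-- A real vector regarded as a complex one. -/
noncomputable def complexify (x : EuclideanSpace ℝ ι) : EuclideanSpace ℂ ι :=
  WithLp.toLp 2 fun i => (x i : ℂ)

/-- The vectors `Re (v j)` and `Im (v j)` as one family. -/
noncomputable def realImagParts (v : κ → EuclideanSpace ℂ ι) : κ ⊕ κ → EuclideanSpace ℝ ι :=
  Sum.elim (fun j => mapCoord Complex.reLm (v j)) fun j => mapCoord Complex.imLm (v j)

lemma star_map_ofReal (A : Matrix ι ι ℝ) :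
    star (A.map Complex.ofReal) = (star A).map Complex.ofReal := by
  ext i j
  simp

variable [Fintype ι]

lemma inner_complexify (z : EuclideanSpace ℂ ι) (x : EuclideanSpace ℝ ι) :
    inner ℂ z (complexify x)
      = inner ℝ (mapCoord Complex.reLm z) x - inner ℝ (mapCoord Complex.imLm z) x * Complex.I := by
  apply Complex.ext <;> simp [complexify, mapCoord, PiLp.inner_apply]

lemma norm_mapCoord_reLm_sq_add_norm_mapCoord_imLm_sq (z : EuclideanSpace ℂ ι) :
    ‖mapCoord Complex.reLm z‖ ^ 2 + ‖mapCoord Complex.imLm z‖ ^ 2 = ‖z‖ ^ 2 := by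
  simp only [EuclideanSpace.norm_sq_eq, ← Finset.sum_add_distrib, Complex.sq_norm,
    Complex.normSq_apply]
  simp [mapCoord, pow_two]

lemma isParsevalFrame_realImagParts [Fintype κ] {v : κ → EuclideanSpace ℂ ι}
    (hv : Orthonormal ℂ v) (hcard : Fintype.card κ = Fintype.card ι) :
    IsParsevalFrame (realImagParts v) := by
  intro x
  have hexpand := sum_inner_smul_of_card_eq_finrank hv (by simpa using hcard) (complexify x)
  ext i
  have hre := congrArg (fun z : EuclideanSpace ℂ ι => (z i).re) hexpand
  simp only [inner_complexify] at hre
  simpa [realImagParts, complexify, mapCoord, Finset.sum_add_distrib] using hre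

variable [DecidableEq ι]

lemma toEuclideanLin_mapCoord (A : Matrix ι ι ℝ) (φ : ℂ →ₗ[ℝ] ℝ) (z : EuclideanSpace ℂ ι) :
    Matrix.toEuclideanLin A (mapCoord φ z)
      = mapCoord φ (Matrix.toEuclideanLin (A.map Complex.ofReal) z) := by
  ext i
  simp [mapCoord, Matrix.toLpLin_apply, Matrix.mulVec, dotProduct, ← Complex.real_smul]

instance (A : Matrix ι ι ℝ) [IsStarNormal A] : IsStarNormal (A.map Complex.ofReal) := ⟨by
  have h := congrArg (fun M : Matrix ι ι ℝ => M.map Complex.ofRealHom) (star_comm_self' A)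
  simp only [Matrix.map_mul] at h
  rw [star_map_ofReal]
  exact h⟩

lemma selfAdjointPart_toEuclideanCLM_mapCoord (A : Matrix ι ι ℝ) [IsStarNormal A]
    {z : EuclideanSpace ℂ ι} {c : ℂ}
    (hz : Matrix.toEuclideanLin (A.map Complex.ofReal) z = c • z) (φ : ℂ →ₗ[ℝ] ℝ) :
    (selfAdjointPart ℝ (Matrix.toEuclideanCLM (𝕜 := ℝ) A) :
      EuclideanSpace ℝ ι →L[ℝ] EuclideanSpace ℝ ι) (mapCoord φ z) = c.re • mapCoord φ z := by
  have hstar : Matrix.toEuclideanLin ((star A).map Complex.ofReal) z = conj c • z := by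
    have h := star_apply_of_isStarNormal (Matrix.toEuclideanCLM (𝕜 := ℂ) (A.map Complex.ofReal)) hz
    rwa [← map_star, star_map_ofReal] at h
  have hA : Matrix.toEuclideanCLM (𝕜 := ℝ) A (mapCoord φ z) = mapCoord φ (c • z) := by
    rw [← hz, ← toEuclideanLin_mapCoord]; rfl
  have hAstar : star (Matrix.toEuclideanCLM (𝕜 := ℝ) A) (mapCoord φ z)
      = mapCoord φ (conj c • z) := by
    rw [← hstar, ← toEuclideanLin_mapCoord, ← map_star]; rfl
  have hre : c • z + conj c • z = (2 * c.re : ℝ) • z := by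
    rw [← add_smul, Complex.add_conj, Complex.coe_smul]
  rw [selfAdjointPart_apply_coe, _root_.smul_apply, _root_.add_apply, hA, hAstar, ← map_add, hre,
    map_smul, smul_smul, ← mul_assoc, invOf_mul_self, one_mul]

end Eigenvectors

theorem theorem3 {m : ℕ} {Ω : Type*} [MeasurableSpace Ω] (P : Measure Ω) [IsProbabilityMeasure P]
    (A : Matrix (Fin m) (Fin m) ℝ)
    (B : ℝ≥0 → Ω → EuclideanSpace ℝ (Fin m)) (hB : IsStandardBrownianMotion B P)
    (X : EuclideanSpace ℝ (Fin m) → ℝ≥0 → Ω → EuclideanSpace ℝ (Fin m))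
    (hX : ∀ x, IsOrnsteinUhlenbeck A (1 : Matrix (Fin m) (Fin m) ℝ) B P x (X x))
    (μ : Measure (EuclideanSpace ℝ (Fin m))) (hμ : IsInvariantDistribution X P μ) :
    (A.PosDef →
      ∀ (l : Fin m → ℝ) (v : Fin m → EuclideanSpace ℝ (Fin m)),
        Orthonormal ℝ v →
        (∀ j, Matrix.toEuclideanLin A (v j) = l j • v j) →
        ∀ (x : EuclideanSpace ℝ (Fin m)) (t : ℝ≥0),
          wassersteinDist 2 (P.map (X x t)) μ =
            ENNReal.ofReal (Real.sqrt (
              ∑ j, Real.exp (-2 * l j * t) * (inner ℝ x (v j)) ^ 2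
              + 1 / 2 * ∑ j, 1 / l j * (Real.exp (-4 * l j * t) /
                  (Real.sqrt (1 - Real.exp (-2 * l j * t)) + 1) ^ 2)))) ∧
    (A * A.transpose = A.transpose * A →
      ∀ (l : Fin m → ℂ) (v : Fin m → EuclideanSpace ℂ (Fin m)),
        (∀ j, 0 < (l j).re) →
        Orthonormal ℂ v →
        (∀ j, Matrix.toEuclideanLin (A.map Complex.ofReal) (v j) = l j • v j) →
        ∀ (x : EuclideanSpace ℝ (Fin m)) (t : ℝ≥0),
          wassersteinDist 2 (P.map (X x t)) μ =
            ENNReal.ofReal (Real.sqrt (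
              ∑ j, Real.exp (-2 * (l j).re * t) *
                ((inner ℝ x (WithLp.toLp 2 fun i => (v j i).re)) ^ 2
                  + (inner ℝ x (WithLp.toLp 2 fun i => (v j i).im)) ^ 2)
              + ∑ j, 1 / (2 * (l j).re) * (Real.exp (-4 * (l j).re * t) /
                  (Real.sqrt (1 - Real.exp (-2 * (l j).re * t)) + 1) ^ 2)))) := by
  refine ⟨fun hA l v hv hl x t => ?_, fun hA l v hpos hv hl x t => ?_⟩
  · have hsymm : IsSelfAdjoint (Matrix.toEuclideanCLM (𝕜 := ℝ) A) :=
      IsSelfAdjoint.map hA.isHermitian _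
    have := hsymm.isStarNormal
    have hw : IsParsevalFrame v := sum_inner_smul_of_card_eq_finrank hv (by simp)
    rw [hw.wassersteinDist_ornsteinUhlenbeck (s := l)
      (by rwa [hsymm.coe_selfAdjointPart_apply ℝ])
      (fun j => eigenvalue_pos_of_posDef hA (hv.ne_zero j) (hl j)) hB hX hμ]
    simp only [hv.1, one_pow, one_mul, Finset.mul_sum, ← mul_assoc, one_div_mul_one_div,
      real_inner_comm x]
  · have : IsStarNormal A := ⟨hA.symm⟩
    have hw : IsParsevalFrame (realImagParts v) := isParsevalFrame_realImagParts hv rfl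
    rw [hw.wassersteinDist_ornsteinUhlenbeck (s := Sum.elim (fun j => (l j).re) fun j => (l j).re)
      (by rintro (j | j) <;> exact selfAdjointPart_toEuclideanCLM_mapCoord A (hl j) _)
      (by rintro (j | j) <;> exact hpos j) hB hX hμ]
    simp only [Fintype.sum_sum_type, realImagParts, Sum.elim_inl, Sum.elim_inr,
      ← Finset.sum_add_distrib, ← mul_add, ← add_mul, real_inner_comm x,
      norm_mapCoord_reLm_sq_add_norm_mapCoord_imLm_sq, hv.1, one_pow, one_mul]
    rfl
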